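/- **Setting.** Fix a signature of object constants, value constants, atomic concepts $A$, atomic roles $P$, attributes $U$ and value domains $T_i$. *Expressions* of $\textit{DL-Lite}_{A,id}$ are $B ::= A \mid \exists Q \mid \delta(U)$, $C ::= B\mid\neg B$, $Q ::= P\mid P^-$, $R ::= Q\mid\neg Q$, $V ::= U \mid \neg U$, $T ::= \top_D\mid T_i$, and *paths* are $\pi ::= S \mid B? \mid \pi_1\circ\pi_2$, where $S$ is an atomic role, the inverse of one, or an attribute. A *TBox* $\mathcal T$ is a finite set of inclusion assertions $B\sqsubseteq C$, $\rho(U)\sqsubseteq T$, $Q\sqsubseteq R$, $U\sqsubseteq V$, attribute functionality assertions $(\mathsf{funct}\ U)$, and identification assertions $(id\ B\ \pi_1,\dots,\pi_n)$, such that (a) every identification assertion is local, i.e. some $\pi_i$ is a single atomic role, inverse of an atomic role, or attribute; and (b) no attribute declared functional, and no role or attribute used as a step of a path of an identification assertion, is specialized, i.e. it does not occur (directly or inverted) as the right-hand side of an inclusion $Q\sqsubseteq Q'$ or $U\sqsubseteq U'$ of $\mathcal T$. $\mathcal T^+$ denotes the set of inclusion assertions in $\mathcal T$ whose right-hand side has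 no $\neg$. An *ABox* is a finite set of *facts* (ABox assertions) $A(a)$, $P(a,b)$, $U(a,v)$, with $a,b$ object constants and $v$ a value constant. An *interpretation* has a nonempty object domain, disjoint from a fixed set of values, which is the union $\top_D$ of the fixed value domains; every intersection of a nonempty finite family of value domains is empty or infinite (as when the value domains are infinite and pairwise disjoint). Different constants denote different elements (unique name assumption), and value constants have a fixed denotation. Concepts denote sets of objects, roles binary relations on objects, attributes relations between objects and values. Here $\exists Q$, $\delta(U)$ and $\rho(U)$ denote the domain of $Q$, the domain of $U$ and the range of $U$; $P^-$ denotes the converse of $P$, $\neg$ the complement, $B?$ the identity relation on $B$, and $\circ$ the composition of relations. Inclusions denote set inclusion, $(\mathsf{funct}\ U)$ says that $U$ is a partial function, and $(id\ B\ \pi_1,\dots,\pi_n)$ says that two instances $x,y$ of $B$ that have, for every $i$, a common $\pi_i$-filler are equal. A *model* of $\langle\mathcal T,\mathcal A\rangle$ is an interpretation satisfying all assertions of $\mathcal T\cup\mathcal A$; $\langle\mathcal T,\mathcal A\rangle$ is *satisfiable* if it has a model. $\mathrm{cl}_{\mathcal T}(\mathcal A)$ is the set of all facts formed with individuals (constants)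 occurring in $\mathcal A$ that hold in every model of $\langle\mathcal T,\mathcal A\rangle$. A set $V$ of facts is a *$\mathcal T$-violation set* if, for some $t\in\mathcal T\setminus\mathcal T^+$, $\langle\mathcal T^+\cup\{t\},V\rangle$ is unsatisfiable while $\langle\mathcal T^+\cup\{t\},V'\rangle$ is satisfiable for every proper subset $V'\subset V$. **Theorem.** Let $\mathcal T$ be a $\textit{DL-Lite}_{A,id}$ TBox and $\mathcal A$ an ABox such that $\langle\mathcal T,\mathcal A\rangle$ is satisfiable, and let $\alpha$ be an ABox assertion such that $\langle\mathcal T,\{\alpha\}\rangle$ is satisfiable. If $\langle\mathcal T,\mathcal A\cup\{\alpha\}\rangle$ is unsatisfiable, then there is a $\mathcal T$-violation set $V\subseteq \mathrm{cl}_{\mathcal T}(\mathcal A\cup\{\alpha\})$ such that (i) $\alpha\in V$ and (ii) $V\setminus\{\alpha\}\subseteq\mathrm{cl}_{\mathcal T}(\mathcal A)$. -/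

import Mathlib

universe u

namespace DLLite

/-- A signature: object constants, value constants, atomic concepts, atomic roles,
attributes, and names of value domains `T₁, …, Tₙ`. -/
structure Signature where
  ObjConst : Type u
  ValConst : Type u
  ConceptName : Type u
  RoleName : Type u
  AttrName : Type u
  ValueDomain : Type u

/-- The fixed data types.  `Val` is the set of all values, i.e. the union `⊤_D` of the value
domains; distinct value constants denote distinct values.  As usual for DL-Lite the domains are
unbounded; `inter_empty_or_infinite` holds in particular when the value domains are infinite and
pairwise disjoint, and also allows, e.g., one infinite data type to be a subtype of another. -/
structure Datatypes (S : Signature.{u}) where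
  Val : Type u
  ext : S.ValueDomain → Set Val
  cover : ∀ v : Val, ∃ D, v ∈ ext D
  inter_empty_or_infinite : ∀ F : Finset S.ValueDomain, F.Nonempty →
    (⋂ D ∈ F, ext D) = ∅ ∨ (⋂ D ∈ F, ext D).Infinite
  val : S.ValConst → Val
  val_injective : Function.Injective val

/-! ### Syntax -/

/-- `Q ⟶ P | P⁻`. -/
inductive BasicRole (S : Signature.{u}) : Type u
  | atom (P : S.RoleName)
  | inv (P : S.RoleName)

/-- The atomic role that occurs in a basic role. -/
def BasicRole.name {S : Signature.{u}} : BasicRole S → S.RoleName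
  | .atom P => P
  | .inv P => P

/-- `B ⟶ A | ∃Q | δ(U)`. -/
inductive BasicConcept (S : Signature.{u}) : Type u
  | atom (A : S.ConceptName)
  | ex (Q : BasicRole S)
  | dom (U : S.AttrName)

/-- `C ⟶ B | ¬B`. -/
inductive GenConcept (S : Signature.{u}) : Type u
  | pos (B : BasicConcept S)
  | neg (B : BasicConcept S)

/-- `R ⟶ Q | ¬Q`. -/
inductive GenRole (S : Signature.{u}) : Type u
  | pos (Q : BasicRole S)
  | neg (Q : BasicRole S)

/-- `V ⟶ U | ¬U`. -/
inductive GenAttr (S : Signature.{u}) : Type u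
  | pos (U : S.AttrName)
  | neg (U : S.AttrName)

/-- `T ⟶ ⊤_D | T₁ | ⋯ | Tₙ`. -/
inductive ValueExpr (S : Signature.{u}) : Type u
  | top
  | dom (D : S.ValueDomain)

/-- `π ⟶ S | B? | π₁ ∘ π₂`, where `S` is a basic role or an attribute. -/
inductive Path (S : Signature.{u}) : Type u
  | role (Q : BasicRole S)
  | attr (U : S.AttrName)
  | test (B : BasicConcept S)
  | comp (p q : Path S)

/-- The path is an atomic role, the inverse of an atomic role, or an attribute. -/
def Path.IsSingleStep {S : Signature.{u}} : Path S → Prop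
  | .role _ => True
  | .attr _ => True
  | .test _ => False
  | .comp _ _ => False

/-- The atomic role `P` is used, directly or inversely, as a step of the path. -/
def Path.UsesRole {S : Signature.{u}} (P : S.RoleName) : Path S → Prop
  | .role Q => Q.name = P
  | .attr _ => False
  | .test _ => False
  | .comp p q => p.UsesRole P ∨ q.UsesRole P

/-- The attribute `U` is used as a step of the path. -/
def Path.UsesAttr {S : Signature.{u}} (U : S.AttrName) : Path S → Prop
  | .role _ => False
  | .attr U' => U' = U
  | .test _ => False
  | .comp p q => p.UsesAttr U ∨ q.UsesAttr U

/-- TBox assertions. -/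
inductive TAssertion (S : Signature.{u}) : Type u
  /-- concept inclusion `B ⊑ C` -/
  | conceptIncl (B : BasicConcept S) (C : GenConcept S)
  /-- value-domain inclusion `ρ(U) ⊑ T` -/
  | rangeIncl (U : S.AttrName) (T : ValueExpr S)
  /-- role inclusion `Q ⊑ R` -/
  | roleIncl (Q : BasicRole S) (R : GenRole S)
  /-- attribute inclusion `U ⊑ V` -/
  | attrIncl (U : S.AttrName) (V : GenAttr S)
  /-- attribute functionality `(funct U)` -/
  | funct (U : S.AttrName)
  /-- identification assertion `(id B π₁, …, πₙ)` -/
  | ident (B : BasicConcept S) (paths : List (Path S))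

/-- Positive inclusions: the inclusion assertions without `¬` on the right-hand side. -/
def TAssertion.IsPositive {S : Signature.{u}} : TAssertion S → Prop
  | .conceptIncl _ (.pos _) => True
  | .conceptIncl _ (.neg _) => False
  | .rangeIncl _ _ => True
  | .roleIncl _ (.pos _) => True
  | .roleIncl _ (.neg _) => False
  | .attrIncl _ (.pos _) => True
  | .attrIncl _ (.neg _) => False
  | .funct _ => False
  | .ident _ _ => False

/-- ABox assertions (facts): `A(a)`, `P(a,b)`, `U(a,v)`. -/
inductive Fact (S : Signature.{u}) : Type u
  | concept (A : S.ConceptName) (a : S.ObjConst)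
  | role (P : S.RoleName) (a b : S.ObjConst)
  | attr (U : S.AttrName) (a : S.ObjConst) (v : S.ValConst)

/-- The object constants occurring in a fact. -/
def Fact.objs {S : Signature.{u}} : Fact S → Set S.ObjConst
  | .concept _ a => {a}
  | .role _ a b => {a, b}
  | .attr _ a _ => {a}

/-- The value constants occurring in a fact. -/
def Fact.vals {S : Signature.{u}} : Fact S → Set S.ValConst
  | .concept _ _ => ∅
  | .role _ _ _ => ∅
  | .attr _ _ v => {v}

/-- `P` is specialized in `𝒯`: `P` or `P⁻` is the right-hand side of a positive role inclusion. -/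
def RoleSpecialized {S : Signature.{u}} (𝒯 : Set (TAssertion S)) (P : S.RoleName) : Prop :=
  ∃ Q Q' : BasicRole S, TAssertion.roleIncl Q (.pos Q') ∈ 𝒯 ∧ Q'.name = P

/-- `U` is specialized in `𝒯`: it is the right-hand side of a positive attribute inclusion. -/
def AttrSpecialized {S : Signature.{u}} (𝒯 : Set (TAssertion S)) (U : S.AttrName) : Prop :=
  ∃ U' : S.AttrName, TAssertion.attrIncl U' (.pos U) ∈ 𝒯

/-- DL-Lite_{A,id} TBoxes: finite sets of TBox assertions such that every identification
assertion is local, and no attribute that is declared functional and no role or attribute that is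
used in a path of an identification assertion is specialized. -/
structure IsTBox {S : Signature.{u}} (𝒯 : Set (TAssertion S)) : Prop where
  finite : 𝒯.Finite
  ident_local : ∀ B ps, TAssertion.ident B ps ∈ 𝒯 → ∃ p ∈ ps, p.IsSingleStep
  funct_attr : ∀ U, TAssertion.funct U ∈ 𝒯 → ¬ AttrSpecialized 𝒯 U
  ident_role : ∀ B ps, TAssertion.ident B ps ∈ 𝒯 → ∀ p ∈ ps, ∀ P,
    p.UsesRole P → ¬ RoleSpecialized 𝒯 P
  ident_attr : ∀ B ps, TAssertion.ident B ps ∈ 𝒯 → ∀ p ∈ ps, ∀ U,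
    p.UsesAttr U → ¬ AttrSpecialized 𝒯 U

/-! ### Semantics -/

/-- First-order interpretations, with an object domain `Obj` disjoint from the fixed set of values
and with the unique name assumption. -/
structure Interp {S : Signature.{u}} (𝔇 : Datatypes S) where
  Obj : Type u
  obj_nonempty : Nonempty Obj
  obj : S.ObjConst → Obj
  obj_injective : Function.Injective obj
  concept : S.ConceptName → Set Obj
  role : S.RoleName → Obj → Obj → Prop
  attr : S.AttrName → Obj → 𝔇.Val → Prop

namespace Interp

variable {S : Signature.{u}} {𝔇 : Datatypes S} (I : Interp 𝔇)

def roleExt : BasicRole S → I.Obj → I.Obj → Prop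
  | .atom P => fun x y => I.role P x y
  | .inv P => fun x y => I.role P y x

def conceptExt : BasicConcept S → Set I.Obj
  | .atom A => I.concept A
  | .ex Q => {x | ∃ y, I.roleExt Q x y}
  | .dom U => {x | ∃ v, I.attr U x v}

def genConceptExt : GenConcept S → Set I.Obj
  | .pos B => I.conceptExt B
  | .neg B => (I.conceptExt B)ᶜ

def genRoleExt : GenRole S → I.Obj → I.Obj → Prop
  | .pos Q => fun x y => I.roleExt Q x y
  | .neg Q => fun x y => ¬ I.roleExt Q x y

def genAttrExt : GenAttr S → I.Obj → 𝔇.Val → Prop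
  | .pos U => fun x v => I.attr U x v
  | .neg U => fun x v => ¬ I.attr U x v

def valueExt (_ : Interp 𝔇) : ValueExpr S → Set 𝔇.Val
  | .top => Set.univ
  | .dom D => 𝔇.ext D

/-- Paths denote binary relations on the whole domain, i.e. objects and values together. -/
def pathExt : Path S → (I.Obj ⊕ 𝔇.Val) → (I.Obj ⊕ 𝔇.Val) → Prop
  | .role Q => fun x y => ∃ a b, x = .inl a ∧ y = .inl b ∧ I.roleExt Q a b
  | .attr U => fun x y => ∃ a v, x = .inl a ∧ y = .inr v ∧ I.attr U a v
  | .test B => fun x y => ∃ a, x = .inl a ∧ y = .inl a ∧ a ∈ I.conceptExt B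
  | .comp p q => fun x y => ∃ z, pathExt p x z ∧ pathExt q z y

/-- Satisfaction of TBox assertions.  An identification assertion `(id B π₁, …, πₙ)` holds if two
different instances of `B` never share a `πᵢ`-filler for every `i`. -/
def satT : TAssertion S → Prop
  | .conceptIncl B C => I.conceptExt B ⊆ I.genConceptExt C
  | .rangeIncl U T => ∀ x v, I.attr U x v → v ∈ I.valueExt T
  | .roleIncl Q R => ∀ x y, I.roleExt Q x y → I.genRoleExt R x y
  | .attrIncl U V => ∀ x v, I.attr U x v → I.genAttrExt V x v
  | .funct U => ∀ x v w, I.attr U x v → I.attr U x w → v = w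
  | .ident B ps => ∀ x ∈ I.conceptExt B, ∀ y ∈ I.conceptExt B,
      (∀ p ∈ ps, ∃ z, I.pathExt p (.inl x) z ∧ I.pathExt p (.inl y) z) → x = y

def satF : Fact S → Prop
  | .concept A a => I.obj a ∈ I.concept A
  | .role P a b => I.role P (I.obj a) (I.obj b)
  | .attr U a v => I.attr U (I.obj a) (𝔇.val v)

/-- `I` is a model of the knowledge base `⟨𝒯, 𝒜⟩`. -/
def IsModel (𝒯 : Set (TAssertion S)) (𝒜 : Set (Fact S)) : Prop :=
  (∀ t ∈ 𝒯, I.satT t) ∧ (∀ f ∈ 𝒜, I.satF f)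

end Interp

/-- `⟨𝒯, 𝒜⟩` is satisfiable. -/
def Satisfiable {S : Signature.{u}} (𝔇 : Datatypes S) (𝒯 : Set (TAssertion S))
    (𝒜 : Set (Fact S)) : Prop :=
  ∃ I : Interp 𝔇, I.IsModel 𝒯 𝒜

/-- `⟨𝒯, 𝒜⟩ ⊨ f`. -/
def Entails {S : Signature.{u}} (𝔇 : Datatypes S) (𝒯 : Set (TAssertion S))
    (𝒜 : Set (Fact S)) (f : Fact S) : Prop :=
  ∀ I : Interp 𝔇, I.IsModel 𝒯 𝒜 → I.satF f

/-- The `𝒯`-closure `cl_𝒯(𝒜)`: all facts formed with individuals in `𝒜` that are logically implied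
by `⟨𝒯, 𝒜⟩`. -/
def closure {S : Signature.{u}} (𝔇 : Datatypes S) (𝒯 : Set (TAssertion S))
    (𝒜 : Set (Fact S)) : Set (Fact S) :=
  {f | f.objs ⊆ (⋃ g ∈ 𝒜, g.objs) ∧ f.vals ⊆ (⋃ g ∈ 𝒜, g.vals) ∧ Entails 𝔇 𝒯 𝒜 f}

/-- `𝒯⁺`: the positive inclusions in `𝒯`. -/
def positivePart {S : Signature.{u}} (𝒯 : Set (TAssertion S)) : Set (TAssertion S) :=
  {t | t ∈ 𝒯 ∧ t.IsPositive}

/-- `V` is a `𝒯`-violation set for `t`. -/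
def IsViolationSetFor {S : Signature.{u}} (𝔇 : Datatypes S) (𝒯 : Set (TAssertion S))
    (t : TAssertion S) (V : Set (Fact S)) : Prop :=
  ¬ Satisfiable 𝔇 (positivePart 𝒯 ∪ {t}) V ∧
    ∀ V', V' ⊂ V → Satisfiable 𝔇 (positivePart 𝒯 ∪ {t}) V'

/-- `V` is a `𝒯`-violation set. -/
def IsViolationSet {S : Signature.{u}} (𝔇 : Datatypes S) (𝒯 : Set (TAssertion S))
    (V : Set (Fact S)) : Prop :=
  ∃ t ∈ 𝒯 \ positivePart 𝒯, IsViolationSetFor 𝔇 𝒯 t V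

end DLLite

namespace DLLite

variable {S : Signature.{u}} {𝔇 : Datatypes S}

/-! A single assertion can always be blamed: if each `t ∈ 𝒯 \ 𝒯⁺` is satisfiable together with `𝒯⁺`
and `𝒜 ∪ {α}`, then so is all of `𝒯` (`satisfiable_union`). The witness is the canonical model of
`𝒯⁺`: the constants with trees of anonymous successors, created only where a node has no base edge
for the role yet, and with pairwise distinct fresh values.

This model maps homomorphically into every model of `𝒯⁺` and the ABox, so it inherits negative
inclusions (`IsFresh.canonical_satT`). Functionality and identification involve equality, which
homomorphisms do not reflect; here the TBox restrictions help. Attributes declared functional and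
the steps of identification paths have only base edges, and by locality a violated identification
could only concern two constants, where the unique name assumption applies.

Positive inclusions can fail only at value domains. Since every inclusion has a single premise, a
concept derived over the union is already derived from `𝒜` or from `{α}` (`type_union`), and their
models provide admissible values.

For the blamed `t`, a minimal unsatisfiable `V ⊆ 𝒜 ∪ {α}` is the required violation set; it contains
`α` because `𝒜` is satisfiable. -/

/-! ### Syntactic consequences of the positive inclusions -/

/-- The inverse of a basic role. -/
def BasicRole.swap : BasicRole S → BasicRole S
  | .atom P => .inv P
  | .inv P => .atom P

@[simp] theorem BasicRole.swap_swap (Q : BasicRole S) : Q.swap.swap = Q := by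
  cases Q <;> rfl

@[simp] theorem BasicRole.name_swap (Q : BasicRole S) : Q.swap.name = Q.name := by
  cases Q <;> rfl

theorem Interp.roleExt_swap (I : Interp 𝔇) (Q : BasicRole S) (x y : I.Obj) :
    I.roleExt Q.swap x y ↔ I.roleExt Q y x := by
  cases Q <;> rfl

/-- `Q ⊑ Q'` is an inclusion of the TBox, possibly after inverting both sides. -/
def RoleStep (𝒯 : Set (TAssertion S)) (Q Q' : BasicRole S) : Prop :=
  .roleIncl Q (.pos Q') ∈ 𝒯 ∨ .roleIncl Q.swap (.pos Q'.swap) ∈ 𝒯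

def AttrStep (𝒯 : Set (TAssertion S)) (U U' : S.AttrName) : Prop :=
  .attrIncl U (.pos U') ∈ 𝒯

/-- Role inclusions act on domains and, since `RoleStep` allows inverting both sides, also on
ranges. -/
inductive ConceptStep (𝒯 : Set (TAssertion S)) : BasicConcept S → BasicConcept S → Prop
  | incl {B B'} (h : .conceptIncl B (.pos B') ∈ 𝒯) : ConceptStep 𝒯 B B'
  | ex {Q Q'} (h : RoleStep 𝒯 Q Q') : ConceptStep 𝒯 (.ex Q) (.ex Q')
  | dom {U U'} (h : AttrStep 𝒯 U U') : ConceptStep 𝒯 (.dom U) (.dom U')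

abbrev RoleSub (𝒯 : Set (TAssertion S)) := Relation.ReflTransGen (RoleStep 𝒯)
abbrev AttrSub (𝒯 : Set (TAssertion S)) := Relation.ReflTransGen (AttrStep 𝒯)
abbrev ConceptSub (𝒯 : Set (TAssertion S)) := Relation.ReflTransGen (ConceptStep 𝒯)

variable {𝒯 : Set (TAssertion S)} {𝒜 : Set (Fact S)}

theorem RoleStep.swap {Q Q' : BasicRole S} (h : RoleStep 𝒯 Q Q') :
    RoleStep 𝒯 Q.swap Q'.swap := by
  rcases h with h | h
  · exact .inr (by simpa using h)
  · exact .inl h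

theorem RoleSub.swap {Q Q' : BasicRole S} (h : RoleSub 𝒯 Q Q') :
    RoleSub 𝒯 Q.swap Q'.swap :=
  Relation.ReflTransGen.lift BasicRole.swap (fun _ _ => RoleStep.swap) _ _ h

theorem RoleSub.conceptSub {Q Q' : BasicRole S} (h : RoleSub 𝒯 Q Q') :
    ConceptSub 𝒯 (.ex Q) (.ex Q') :=
  Relation.ReflTransGen.lift BasicConcept.ex (fun _ _ => ConceptStep.ex) _ _ h

theorem AttrSub.conceptSub {U U' : S.AttrName} (h : AttrSub 𝒯 U U') :
    ConceptSub 𝒯 (.dom U) (.dom U') :=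
  Relation.ReflTransGen.lift BasicConcept.dom (fun _ _ => ConceptStep.dom) _ _ h

/-- The last step of a nontrivial chain would specialize `Q'`. Hence the canonical model has only
base edges for such a role. -/
theorem RoleSub.eq_of_not_specialized {Q Q' : BasicRole S} (h : RoleSub 𝒯 Q Q')
    (hQ' : ¬ RoleSpecialized 𝒯 Q'.name) : Q = Q' := by
  rcases Relation.ReflTransGen.cases_tail h with h | ⟨R, -, h | h⟩
  · exact h.symm
  · exact absurd ⟨_, _, h, rfl⟩ hQ'
  · exact absurd ⟨_, _, h, by simp⟩ hQ'

theorem AttrSub.eq_of_not_specialized {U U' : S.AttrName} (h : AttrSub 𝒯 U U')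
    (hU' : ¬ AttrSpecialized 𝒯 U') : U = U' := by
  rcases Relation.ReflTransGen.cases_tail h with h | ⟨R, -, h⟩
  · exact h.symm
  · exact absurd ⟨_, h⟩ hU'

namespace Interp

variable {I : Interp 𝔇}

theorem roleExt_of_roleSub (hI : ∀ t ∈ positivePart 𝒯, I.satT t) {Q Q' : BasicRole S}
    (h : RoleSub 𝒯 Q Q') {x y : I.Obj} (hxy : I.roleExt Q x y) : I.roleExt Q' x y := by
  induction h with
  | refl => exact hxy
  | tail _ hs ih =>
    rcases hs with hs | hs
    · exact hI _ ⟨hs, trivial⟩ x y ih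
    · have := hI _ ⟨hs, trivial⟩ y x ((I.roleExt_swap _ _ _).2 ih)
      exact (I.roleExt_swap _ _ _).1 this

theorem attr_of_attrSub (hI : ∀ t ∈ positivePart 𝒯, I.satT t) {U U' : S.AttrName}
    (h : AttrSub 𝒯 U U') {x : I.Obj} {v : 𝔇.Val} (hxv : I.attr U x v) : I.attr U' x v := by
  induction h with
  | refl => exact hxv
  | tail _ hs ih => exact hI _ ⟨hs, trivial⟩ x v ih

theorem conceptExt_of_conceptSub (hI : ∀ t ∈ positivePart 𝒯, I.satT t) {B B' : BasicConcept S}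
    (h : ConceptSub 𝒯 B B') {x : I.Obj} (hx : x ∈ I.conceptExt B) : x ∈ I.conceptExt B' := by
  induction h with
  | refl => exact hx
  | tail _ hs ih =>
    cases hs with
    | incl hs => exact hI _ ⟨hs, trivial⟩ ih
    | ex hs =>
      obtain ⟨y, hy⟩ := ih
      exact ⟨y, roleExt_of_roleSub hI (.single hs) hy⟩
    | dom hs =>
      obtain ⟨v, hv⟩ := ih
      exact ⟨v, attr_of_attrSub hI (.single hs) hv⟩

end Interp

/-! ### Asserted roles and concepts -/

/-- The basic concept memberships stated by a fact. -/
def Fact.basics : Fact S → Set (S.ObjConst × BasicConcept S)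
  | .concept A a => {(a, .atom A)}
  | .role P a b => {(a, .ex (.atom P)), (b, .ex (.inv P))}
  | .attr U a _ => {(a, .dom U)}

theorem Fact.finite_basics (f : Fact S) : f.basics.Finite := by
  cases f <;> simp [Fact.basics]

def AssertedRole (𝒜 : Set (Fact S)) : BasicRole S → S.ObjConst → S.ObjConst → Prop
  | .atom P, a, b => .role P a b ∈ 𝒜
  | .inv P, a, b => .role P b a ∈ 𝒜

theorem assertedRole_swap {Q : BasicRole S} {a b : S.ObjConst} :
    AssertedRole 𝒜 Q.swap a b ↔ AssertedRole 𝒜 Q b a := by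
  cases Q <;> rfl

theorem AssertedRole.basics {Q : BasicRole S} {a b : S.ObjConst} (h : AssertedRole 𝒜 Q a b) :
    ∃ f ∈ 𝒜, (a, .ex Q) ∈ f.basics := by
  cases Q <;> exact ⟨_, h, by simp [Fact.basics]⟩

theorem Interp.roleExt_of_asserted {I : Interp 𝔇} (hI : ∀ f ∈ 𝒜, I.satF f) {Q : BasicRole S}
    {a b : S.ObjConst} (h : AssertedRole 𝒜 Q a b) : I.roleExt Q (I.obj a) (I.obj b) := by
  cases Q <;> exact hI _ h

theorem Interp.conceptExt_of_basics {I : Interp 𝔇} {f : Fact S} (hf : I.satF f)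
    {a : S.ObjConst} {B : BasicConcept S} (h : (a, B) ∈ f.basics) :
    I.obj a ∈ I.conceptExt B := by
  cases f with
  | concept A b =>
    obtain ⟨rfl, rfl⟩ := Prod.mk.inj (Set.mem_singleton_iff.1 h)
    exact hf
  | role P b c =>
    rcases h with h | h
    · obtain ⟨rfl, rfl⟩ := Prod.mk.inj h
      exact ⟨_, hf⟩
    · obtain ⟨rfl, rfl⟩ := Prod.mk.inj (Set.mem_singleton_iff.1 h)
      exact ⟨_, hf⟩
  | attr U b v =>
    obtain ⟨rfl, rfl⟩ := Prod.mk.inj (Set.mem_singleton_iff.1 h)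
    exact ⟨_, hf⟩

/-! ### Nodes of the canonical model -/

/-- The objects of the canonical model: the constants, and for every node and every basic role a
potential successor. -/
inductive Node (S : Signature.{u}) : Type u
  | const (a : S.ObjConst)
  | succ (x : Node S) (Q : BasicRole S)

namespace Node

def depth : Node S → ℕ
  | const _ => 0
  | succ x _ => x.depth + 1

/-- The node already has a `Q`-successor, by an asserted fact or because its predecessor is one. -/
def Blocked (𝒜 : Set (Fact S)) (Q : BasicRole S) : Node S → Prop
  | const a => ∃ b, AssertedRole 𝒜 Q a b
  | succ _ Q' => Q = Q'.swap

/-- The basic concepts to which the node belongs; none for nodes that are not generated. -/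
def type (𝒯 : Set (TAssertion S)) (𝒜 : Set (Fact S)) : Node S → Set (BasicConcept S)
  | const a => {B | ∃ B₀, (∃ f ∈ 𝒜, (a, B₀) ∈ f.basics) ∧ ConceptSub 𝒯 B₀ B}
  | succ x Q => {B | .ex Q ∈ type 𝒯 𝒜 x ∧ ¬ x.Blocked 𝒜 Q ∧ ConceptSub 𝒯 (.ex Q.swap) B}

/-- The successor `x.succ Q` is generated. -/
def Generates (𝒯 : Set (TAssertion S)) (𝒜 : Set (Fact S)) (x : Node S) (Q : BasicRole S) : Prop :=
  .ex Q ∈ x.type 𝒯 𝒜 ∧ ¬ x.Blocked 𝒜 Q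

/-- The role edges before closing under role inclusions. -/
inductive BaseRole (𝒯 : Set (TAssertion S)) (𝒜 : Set (Fact S)) :
    BasicRole S → Node S → Node S → Prop
  | asserted {Q a b} (h : AssertedRole 𝒜 Q a b) : BaseRole 𝒯 𝒜 Q (const a) (const b)
  | child {Q x} (h : x.Generates 𝒯 𝒜 Q) : BaseRole 𝒯 𝒜 Q x (x.succ Q)
  | parent {Q y} (h : y.Generates 𝒯 𝒜 (BasicRole.swap Q)) : BaseRole 𝒯 𝒜 Q (y.succ Q.swap) y

/-- A choice of a value for every node in the domain of an attribute. -/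
abbrev ValueChoice (𝔇 : Datatypes S) (𝒯 : Set (TAssertion S)) (𝒜 : Set (Fact S)) :=
  ∀ (x : Node S) (U : S.AttrName), .dom U ∈ x.type 𝒯 𝒜 → 𝔇.Val

/-- The attribute edges before closing under attribute inclusions; `ν` chooses the fresh values. -/
inductive BaseAttr (𝔇 : Datatypes S) (𝒯 : Set (TAssertion S)) (𝒜 : Set (Fact S))
    (ν : ValueChoice 𝔇 𝒯 𝒜) : S.AttrName → Node S → 𝔇.Val → Prop
  | asserted {U a c} (h : .attr U a c ∈ 𝒜) : BaseAttr 𝔇 𝒯 𝒜 ν U (const a) (𝔇.val c)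
  | fresh {U x} (h : .dom U ∈ x.type 𝒯 𝒜) (hx : ∀ a c, x = const a → .attr U a c ∉ 𝒜) :
      BaseAttr 𝔇 𝒯 𝒜 ν U x (ν x U h)

theorem type_of_conceptSub {x : Node S} {B B' : BasicConcept S} (h : ConceptSub 𝒯 B B')
    (hB : B ∈ x.type 𝒯 𝒜) : B' ∈ x.type 𝒯 𝒜 := by
  cases x with
  | const a =>
    obtain ⟨B₀, h₀, h₁⟩ := hB
    exact ⟨B₀, h₀, h₁.trans h⟩
  | succ x Q => exact ⟨hB.1, hB.2.1, hB.2.2.trans h⟩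

theorem BaseRole.swap {Q : BasicRole S} {x y : Node S} (h : BaseRole 𝒯 𝒜 Q x y) :
    BaseRole 𝒯 𝒜 Q.swap y x := by
  cases h with
  | asserted h => exact .asserted (assertedRole_swap.2 h)
  | child h =>
    have := BaseRole.parent (Q := Q.swap) (by simpa using h)
    simpa using this
  | parent h => exact .child h

theorem BaseRole.mem_type {Q : BasicRole S} {x y : Node S} (h : BaseRole 𝒯 𝒜 Q x y) :
    .ex Q ∈ x.type 𝒯 𝒜 := by
  cases h with
  | asserted h => exact ⟨_, h.basics, .refl⟩
  | child h => exact h.1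
  | parent h =>
    refine ⟨h.1, h.2, ?_⟩
    rw [BasicRole.swap_swap]

/-- Blocking costs no filler: a blocked constant has an asserted one, a blocked successor has its
predecessor. -/
theorem exists_baseRole {Q : BasicRole S} {x : Node S} (h : .ex Q ∈ x.type 𝒯 𝒜) :
    ∃ y, BaseRole 𝒯 𝒜 Q x y := by
  by_cases hb : x.Blocked 𝒜 Q
  · cases x with
    | const a =>
      obtain ⟨b, hb⟩ := hb
      exact ⟨_, .asserted hb⟩
    | succ x Q' =>
      obtain rfl : Q = Q'.swap := hb
      have := BaseRole.child (𝒯 := 𝒯) (𝒜 := 𝒜) (x := x) (Q := Q') ⟨h.1, h.2.1⟩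
      exact ⟨x, this.swap⟩
  · exact ⟨_, .child ⟨h, hb⟩⟩

theorem BaseAttr.mem_type {ν : ValueChoice 𝔇 𝒯 𝒜} {U : S.AttrName} {x : Node S}
    {v : 𝔇.Val} (h : BaseAttr 𝔇 𝒯 𝒜 ν U x v) : .dom U ∈ x.type 𝒯 𝒜 := by
  cases h with
  | asserted h => exact ⟨_, ⟨_, h, rfl⟩, .refl⟩
  | fresh h => exact h

theorem exists_baseAttr {ν : ValueChoice 𝔇 𝒯 𝒜} {U : S.AttrName} {x : Node S}
    (h : .dom U ∈ x.type 𝒯 𝒜) : ∃ v, BaseAttr 𝔇 𝒯 𝒜 ν U x v := by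
  by_cases hx : ∃ a c, x = const a ∧ .attr U a c ∈ 𝒜
  · obtain ⟨a, c, rfl, hc⟩ := hx
    exact ⟨_, .asserted hc⟩
  · push Not at hx
    exact ⟨_, .fresh h hx⟩

/-- Two nodes with a common `Q`-filler along base edges are equal or both constants. -/
theorem BaseRole.eq_or_const {Q : BasicRole S} {x y z : Node S} (hx : BaseRole 𝒯 𝒜 Q x z)
    (hy : BaseRole 𝒯 𝒜 Q y z) : x = y ∨ ∃ a b, x = const a ∧ y = const b := by
  cases hx with
  | asserted h =>
    cases hy with
    | asserted h' => exact .inr ⟨_, _, rfl, rfl⟩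
    -- The filler would generate a `Q.swap`-successor although it already has an edge of that kind,
    -- which blocking forbids. The other mixed cases fail alike.
    | parent h' => exact absurd ⟨_, assertedRole_swap.2 h⟩ h'.2
  | child h =>
    cases hy with
    | child h' => exact .inl rfl
    | parent h' => exact absurd rfl h'.2
  | parent h =>
    cases hy with
    | asserted h' => exact absurd ⟨_, assertedRole_swap.2 h'⟩ h.2
    | child h' => exact absurd rfl h.2
    | parent h' => exact .inl rfl

/-- The types over a union of two ABoxes come from the two ABoxes. -/
theorem type_union {𝒜 ℬ : Set (Fact S)} {x : Node S} {B : BasicConcept S}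
    (h : B ∈ x.type 𝒯 (𝒜 ∪ ℬ)) : B ∈ x.type 𝒯 𝒜 ∨ B ∈ x.type 𝒯 ℬ := by
  induction x generalizing B with
  | const a =>
    obtain ⟨B₀, ⟨f, hf | hf, hB₀⟩, hB⟩ := h
    · exact .inl ⟨B₀, ⟨f, hf, hB₀⟩, hB⟩
    · exact .inr ⟨B₀, ⟨f, hf, hB₀⟩, hB⟩
  | succ x Q ih =>
    obtain ⟨h₁, h₂, h₃⟩ := h
    -- Blocking is monotone in the ABox.
    have mono : ∀ 𝒞 ⊆ 𝒜 ∪ ℬ, ¬ x.Blocked 𝒞 Q := by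
      intro 𝒞 h𝒞 hb
      cases x with
      | const a =>
        obtain ⟨b, hb⟩ := hb
        exact h₂ ⟨b, by cases Q <;> exact h𝒞 hb⟩
      | succ x Q' => exact h₂ hb
    rcases ih h₁ with h₁ | h₁
    · exact .inl ⟨h₁, mono _ Set.subset_union_left, h₃⟩
    · exact .inr ⟨h₁, mono _ Set.subset_union_right, h₃⟩

end Node

/-! ### Countability of the generated part -/

/-- The basic concepts on the right-hand side of the steps induced by an assertion. -/
def TAssertion.heads : TAssertion S → Set (BasicConcept S)
  | .conceptIncl _ (.pos B) => {B}
  | .roleIncl _ (.pos Q) => {.ex Q, .ex Q.swap}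
  | .attrIncl _ (.pos U) => {.dom U}
  | _ => ∅

theorem TAssertion.finite_heads (t : TAssertion S) : t.heads.Finite := by
  unfold TAssertion.heads
  split <;> simp

theorem ConceptStep.mem_heads {B B' : BasicConcept S} (h : ConceptStep 𝒯 B B') :
    B' ∈ ⋃ t ∈ 𝒯, t.heads := by
  rw [Set.mem_iUnion₂]
  cases h with
  | incl h => exact ⟨_, h, rfl⟩
  | ex h =>
    rcases h with h | h
    · exact ⟨_, h, .inl rfl⟩
    · exact ⟨_, h, .inr (by simp)⟩
  | dom h => exact ⟨_, h, rfl⟩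

theorem countable_conceptSub (h𝒯 : 𝒯.Finite) (B : BasicConcept S) :
    {B' | ConceptSub 𝒯 B B'}.Countable := by
  have hfin : (⋃ t ∈ 𝒯, t.heads).Finite := h𝒯.biUnion fun t _ => t.finite_heads
  refine (hfin.insert B).countable.mono fun B' hB' => ?_
  rcases Relation.ReflTransGen.cases_tail hB' with h | ⟨_, -, h⟩
  · exact .inl h
  · exact .inr h.mem_heads

namespace Node

/-- The signature may be uncountable, but each generated node comes from a node-concept pair one
level up. Countability matters because the infinite value sets may be only countable. -/
theorem countable_type (h𝒯 : 𝒯.Finite) (h𝒜 : 𝒜.Finite) :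
    {p : Node S × BasicConcept S | p.2 ∈ p.1.type 𝒯 𝒜}.Countable := by
  have key : ∀ n, {p : Node S × BasicConcept S | p.1.depth = n ∧ p.2 ∈ p.1.type 𝒯 𝒜}.Countable := by
    intro n
    induction n with
    | zero =>
      have hfin : (⋃ f ∈ 𝒜, f.basics).Finite := h𝒜.biUnion fun f _ => f.finite_basics
      refine (hfin.countable.biUnion (t := fun q _ => Prod.mk (const q.1) ''
        {B | ConceptSub 𝒯 q.2 B}) fun q _ => (countable_conceptSub h𝒯 q.2).image _).mono ?_
      rintro ⟨x, B⟩ ⟨hx, hB⟩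
      cases x with
      | const a =>
        obtain ⟨B₀, ⟨f, hf, hB₀⟩, hB⟩ := hB
        exact Set.mem_iUnion₂.2 ⟨(a, B₀), Set.mem_iUnion₂.2 ⟨f, hf, hB₀⟩, B, hB, rfl⟩
      | succ x Q => exact absurd hx (Nat.succ_ne_zero _)
    | succ n ih =>
      have hinj : Function.Injective
          (fun q : Node S × BasicRole S => (q.1, BasicConcept.ex q.2)) := by
        rintro ⟨x, Q⟩ ⟨y, R⟩ h
        simpa using h
      refine ((ih.preimage hinj).biUnion (t := fun q _ => Prod.mk (succ q.1 q.2) ''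
        {B | ConceptSub 𝒯 (.ex q.2.swap) B})
        fun q _ => (countable_conceptSub h𝒯 _).image _).mono ?_
      rintro ⟨x, B⟩ ⟨hx, hB⟩
      cases x with
      | const a => exact absurd hx.symm (Nat.succ_ne_zero _)
      | succ x Q =>
        exact Set.mem_iUnion₂.2 ⟨(x, Q), ⟨Nat.succ.inj hx, hB.1⟩, B, hB.2.2, rfl⟩
  exact (Set.countable_iUnion key).mono fun p hp =>
    Set.mem_iUnion_of_mem p.1.depth (And.intro rfl hp)

end Node

/-- Countably many infinite sets have distinct representatives outside a given finite set. -/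
theorem exists_injective_mem_of_infinite {ι β : Type*} [Countable ι] {D : ι → Set β}
    (hD : ∀ i, (D i).Infinite) {F : Set β} (hF : F.Finite) :
    ∃ f : ι → β, Function.Injective f ∧ ∀ i, f i ∈ D i \ F := by
  obtain ⟨e, he⟩ := exists_injective_nat ι
  -- Junk values for infinite `G` keep finiteness proofs out of the recursion.
  have pick : ∀ i (G : Set β), ∃ b, G.Finite → b ∈ D i \ F ∧ b ∉ G := by
    intro i G
    by_cases hG : G.Finite
    · obtain ⟨b, hb, hb'⟩ := (hD i).exists_notMem_finite (hF.union hG)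
      exact ⟨b, fun _ => ⟨⟨hb, fun h => hb' (.inl h)⟩, fun h => hb' (.inr h)⟩⟩
    · exact ⟨(hD i).nonempty.some, fun h => absurd h hG⟩
  choose p hp using pick
  -- Recursion along the enumeration `e`: each choice avoids the finitely many earlier ones.
  have wf : WellFounded (InvImage (· < ·) e) := InvImage.wf e wellFounded_lt
  let f : ι → β := wf.fix fun i g => p i (Set.range fun j : {j // e j < e i} => g j.1 j.2)
  have hf : ∀ i, f i = p i (Set.range fun j : {j // e j < e i} => f j.1) :=
    fun i => wf.fix_eq _ i
  have hfin : ∀ i, (Set.range fun j : {j // e j < e i} => f j.1).Finite := by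
    intro i
    have : Finite {j // e j < e i} := ((Set.finite_Iio (e i)).preimage he.injOn).to_subtype
    exact Set.finite_range _
  have hmem : ∀ i, f i ∈ D i \ F := fun i => hf i ▸ (hp i _ (hfin i)).1
  have hne : ∀ i j, e j < e i → f j ≠ f i := by
    intro i j hji h
    refine (hp i _ (hfin i)).2 ?_
    rw [← hf i, ← h]
    exact ⟨⟨j, hji⟩, rfl⟩
  refine ⟨f, fun i j hij => ?_, hmem⟩
  by_contra hne'
  rcases lt_or_gt_of_ne (he.ne hne') with h | h
  · exact hne _ _ h hij
  · exact hne _ _ h hij.symm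

/-! ### The canonical model -/

/-- The canonical interpretation with fresh values `ν`. -/
def canonical (𝔇 : Datatypes S) (𝒯 : Set (TAssertion S)) (𝒜 : Set (Fact S)) (a₀ : S.ObjConst)
    (ν : Node.ValueChoice 𝔇 𝒯 𝒜) : Interp 𝔇 where
  Obj := Node S
  obj_nonempty := ⟨.const a₀⟩
  obj := .const
  obj_injective := fun _ _ h => by injection h
  concept A := {x | .atom A ∈ x.type 𝒯 𝒜}
  role P x y := ∃ Q, RoleSub 𝒯 Q (.atom P) ∧ Node.BaseRole 𝒯 𝒜 Q x y
  attr U x v := ∃ U₀, AttrSub 𝒯 U₀ U ∧ Node.BaseAttr 𝔇 𝒯 𝒜 ν U₀ x v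

section Canonical

variable {a₀ : S.ObjConst} {ν : Node.ValueChoice 𝔇 𝒯 𝒜}

theorem canonical_roleExt {Q : BasicRole S} {x y : Node S} :
    (canonical 𝔇 𝒯 𝒜 a₀ ν).roleExt Q x y ↔
      ∃ Q₀, RoleSub 𝒯 Q₀ Q ∧ Node.BaseRole 𝒯 𝒜 Q₀ x y := by
  cases Q with
  | atom P => rfl
  | inv P =>
    constructor
    · rintro ⟨Q₀, h, hb⟩
      exact ⟨Q₀.swap, RoleSub.swap h, hb.swap⟩
    · rintro ⟨Q₀, h, hb⟩
      exact ⟨Q₀.swap, RoleSub.swap h, hb.swap⟩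

/-- Closing the edges under inclusions adds no memberships, since types are upward closed;
conversely base edges witness every `∃Q` and `δ(U)` in a type. -/
theorem canonical_conceptExt {B : BasicConcept S} {x : Node S} :
    x ∈ (canonical 𝔇 𝒯 𝒜 a₀ ν).conceptExt B ↔ B ∈ x.type 𝒯 𝒜 := by
  cases B with
  | atom A => rfl
  | ex Q =>
    constructor
    · rintro ⟨y, hy⟩
      obtain ⟨Q₀, h, hb⟩ := canonical_roleExt.1 hy
      exact Node.type_of_conceptSub (RoleSub.conceptSub h) hb.mem_type
    · intro h
      obtain ⟨y, hy⟩ := Node.exists_baseRole h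
      exact ⟨y, canonical_roleExt.2 ⟨Q, .refl, hy⟩⟩
  | dom U =>
    constructor
    · rintro ⟨v, U₀, h, hb⟩
      exact Node.type_of_conceptSub (AttrSub.conceptSub h) hb.mem_type
    · intro h
      obtain ⟨v, hv⟩ := Node.exists_baseAttr h
      exact ⟨v, U, .refl, hv⟩

/-- The canonical interpretation satisfies the facts. -/
theorem canonical_satF {f : Fact S} (hf : f ∈ 𝒜) : (canonical 𝔇 𝒯 𝒜 a₀ ν).satF f := by
  cases f with
  | concept A a => exact ⟨_, ⟨_, hf, rfl⟩, .refl⟩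
  | role P a b => exact ⟨.atom P, .refl, .asserted hf⟩
  | attr U a c => exact ⟨U, .refl, .asserted hf⟩

/-- The canonical interpretation satisfies the positive inclusions if the base attribute edges
respect the value domains. -/
theorem canonical_satT_of_isPositive
    (hν : ∀ U U' x v T, Node.BaseAttr 𝔇 𝒯 𝒜 ν U x v → AttrSub 𝒯 U U' →
      .rangeIncl U' (.dom T) ∈ 𝒯 → v ∈ 𝔇.ext T)
    {t : TAssertion S} (ht : t ∈ positivePart 𝒯) : (canonical 𝔇 𝒯 𝒜 a₀ ν).satT t := by
  obtain ⟨ht, hpos⟩ := ht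
  cases t with
  | conceptIncl B C =>
    cases C with
    | pos B' =>
      intro x hx
      exact canonical_conceptExt.2
        (Node.type_of_conceptSub (.single (.incl ht)) (canonical_conceptExt.1 hx))
    | neg B' => exact hpos.elim
  | rangeIncl U T =>
    rintro x v ⟨U₀, h, hb⟩
    cases T with
    | top => trivial
    | dom D => exact hν _ _ _ _ _ hb h ht
  | roleIncl Q R =>
    cases R with
    | pos Q' =>
      intro x y hxy
      obtain ⟨Q₀, h, hb⟩ := canonical_roleExt.1 hxy
      exact canonical_roleExt.2 ⟨Q₀, h.tail (.inl ht), hb⟩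
    | neg Q' => exact hpos.elim
  | attrIncl U V =>
    cases V with
    | pos U' =>
      rintro x v ⟨U₀, h, hb⟩
      exact ⟨U₀, h.tail ht, hb⟩
    | neg U' => exact hpos.elim
  | funct U => exact hpos.elim
  | ident B ps => exact hpos.elim

end Canonical

/-! ### Mapping the canonical model into other models -/

namespace Interp

open Classical in
/-- The image of a node, following chosen role fillers. -/
noncomputable def nodeMap (I : Interp 𝔇) : Node S → I.Obj
  | .const a => I.obj a
  -- The default is irrelevant for generated nodes: there the image of `x` has a `Q`-filler in any
  -- model of the positive inclusions and the ABox.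
  | .succ x Q => if h : ∃ y, I.roleExt Q (I.nodeMap x) y then h.choose else I.nodeMap x

variable {I : Interp 𝔇}

theorem roleExt_nodeMap_succ {x : Node S} {Q : BasicRole S}
    (h : I.nodeMap x ∈ I.conceptExt (.ex Q)) :
    I.roleExt Q (I.nodeMap x) (I.nodeMap (x.succ Q)) := by
  have h' : ∃ y, I.roleExt Q (I.nodeMap x) y := h
  simp only [nodeMap, dif_pos h']
  exact h'.choose_spec

/-- Induction along generation: the predecessor lies in `∃Q`, so its chosen filler is a genuine one
and satisfies everything above `∃Q⁻`. -/
theorem nodeMap_mem_conceptExt (hI : I.IsModel (positivePart 𝒯) 𝒜) {x : Node S}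
    {B : BasicConcept S} (h : B ∈ x.type 𝒯 𝒜) : I.nodeMap x ∈ I.conceptExt B := by
  induction x generalizing B with
  | const a =>
    obtain ⟨B₀, ⟨f, hf, hB₀⟩, hB⟩ := h
    exact conceptExt_of_conceptSub hI.1 hB (conceptExt_of_basics (hI.2 f hf) hB₀)
  | succ x Q ih =>
    refine conceptExt_of_conceptSub hI.1 h.2.2 ⟨I.nodeMap x, ?_⟩
    exact (I.roleExt_swap _ _ _).2 (roleExt_nodeMap_succ (ih h.1))

theorem roleExt_nodeMap (hI : I.IsModel (positivePart 𝒯) 𝒜) {x y : Node S} {Q : BasicRole S}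
    (h : Node.BaseRole 𝒯 𝒜 Q x y) : I.roleExt Q (I.nodeMap x) (I.nodeMap y) := by
  cases h with
  | asserted h => exact roleExt_of_asserted hI.2 h
  | child h => exact roleExt_nodeMap_succ (nodeMap_mem_conceptExt hI h.1)
  | parent h =>
    exact (I.roleExt_swap _ _ _).1 (roleExt_nodeMap_succ (nodeMap_mem_conceptExt hI h.1))

end Interp

/-- The values assigned to generated attribute edges are pairwise different, and different from the
values that occur in the ABox. -/
structure IsFresh (𝔇 : Datatypes S) (𝒯 : Set (TAssertion S)) (𝒜 : Set (Fact S))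
    (ν : Node.ValueChoice 𝔇 𝒯 𝒜) : Prop where
  inj : ∀ x U y U' hx hy, ν x U hx = ν y U' hy → x = y ∧ U = U'
  ne_val : ∀ x U hx U' a c, .attr U' a c ∈ 𝒜 → ν x U hx ≠ 𝔇.val c

section Hom

variable {a₀ : S.ObjConst} {ν : Node.ValueChoice 𝔇 𝒯 𝒜} {I : Interp 𝔇}

/-- Two nodes with a common value along base edges are equal or both constants. -/
theorem IsFresh.eq_or_const (hν : IsFresh 𝔇 𝒯 𝒜 ν) {U U' : S.AttrName} {x y : Node S}
    {v w : 𝔇.Val} (hx : Node.BaseAttr 𝔇 𝒯 𝒜 ν U x v) (hy : Node.BaseAttr 𝔇 𝒯 𝒜 ν U' y w)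
    (hvw : v = w) : x = y ∨ ∃ a b, x = .const a ∧ y = .const b := by
  cases hx with
  | asserted hx =>
    cases hy with
    | asserted hy => exact .inr ⟨_, _, rfl, rfl⟩
    | fresh hy _ => exact absurd hvw.symm (hν.ne_val _ _ hy _ _ _ hx)
  | fresh hx _ =>
    cases hy with
    | asserted hy => exact absurd hvw (hν.ne_val _ _ hx _ _ _ hy)
    | fresh hy _ => exact .inl (hν.inj _ _ _ _ hx hy hvw).1

/-- A fresh value lies on at most one base edge, so it may go to any filler in `I`; the remaining
values stay fixed, as asserted edges require. -/
theorem IsFresh.exists_valueMap (hν : IsFresh 𝔇 𝒯 𝒜 ν) (hI : I.IsModel (positivePart 𝒯) 𝒜) :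
    ∃ g : 𝔇.Val → 𝔇.Val, ∀ U x v, (canonical 𝔇 𝒯 𝒜 a₀ ν).attr U x v →
      I.attr U (I.nodeMap x) (g v) := by
  classical
  have key : ∀ v, ∃ w, ∀ U x, Node.BaseAttr 𝔇 𝒯 𝒜 ν U x v → I.attr U (I.nodeMap x) w := by
    intro v
    by_cases hv : ∃ x U hU, v = ν x U hU
    · obtain ⟨x, U, hU, rfl⟩ := hv
      obtain ⟨w, hw⟩ := Interp.nodeMap_mem_conceptExt hI hU
      refine ⟨w, fun U' x' h => ?_⟩
      generalize hv : ν x U hU = v at h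
      cases h with
      | asserted h => exact absurd hv (hν.ne_val _ _ hU _ _ _ h)
      | fresh h _ =>
        obtain ⟨rfl, rfl⟩ := hν.inj _ _ _ _ hU h hv
        exact hw
    · refine ⟨v, fun U x h => ?_⟩
      cases h with
      | asserted h => exact hI.2 _ h
      | fresh h _ => exact absurd ⟨_, _, h, rfl⟩ hv
  choose g hg using key
  refine ⟨g, ?_⟩
  rintro U x v ⟨U₀, h, hb⟩
  exact Interp.attr_of_attrSub hI.1 h (hg v U₀ x hb)

theorem canonical_pathExt_map (hI : I.IsModel (positivePart 𝒯) 𝒜) {g : 𝔇.Val → 𝔇.Val}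
    (hg : ∀ U x v, (canonical 𝔇 𝒯 𝒜 a₀ ν).attr U x v → I.attr U (I.nodeMap x) (g v))
    (p : Path S) {x y : Node S ⊕ 𝔇.Val} (h : (canonical 𝔇 𝒯 𝒜 a₀ ν).pathExt p x y) :
    I.pathExt p (x.map I.nodeMap g) (y.map I.nodeMap g) := by
  induction p generalizing x y with
  | role Q =>
    obtain ⟨a, b, rfl, rfl, h⟩ := h
    obtain ⟨Q₀, h, hb⟩ := canonical_roleExt.1 h
    exact ⟨_, _, rfl, rfl, Interp.roleExt_of_roleSub hI.1 h (Interp.roleExt_nodeMap hI hb)⟩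
  | attr U =>
    obtain ⟨a, v, rfl, rfl, h⟩ := h
    exact ⟨_, _, rfl, rfl, hg _ _ _ h⟩
  | test B =>
    obtain ⟨a, rfl, rfl, h⟩ := h
    exact ⟨_, rfl, rfl, Interp.nodeMap_mem_conceptExt hI (canonical_conceptExt.1 h)⟩
  | comp p q ihp ihq =>
    obtain ⟨z, hp, hq⟩ := h
    exact ⟨_, ihp hp, ihq hq⟩

/-- A negative inclusion, functionality or identification assertion that holds in some model of the
positive inclusions holds in the canonical interpretation. -/
theorem IsFresh.canonical_satT (hν : IsFresh 𝔇 𝒯 𝒜 ν) (h𝒯 : IsTBox 𝒯)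
    (hI : I.IsModel (positivePart 𝒯) 𝒜) {t : TAssertion S} (ht : t ∈ 𝒯) (hpos : ¬ t.IsPositive)
    (hIt : I.satT t) : (canonical 𝔇 𝒯 𝒜 a₀ ν).satT t := by
  obtain ⟨g, hg⟩ := hν.exists_valueMap (a₀ := a₀) hI
  cases t with
  | conceptIncl B C =>
    cases C with
    | pos B' => exact absurd trivial hpos
    | neg B' =>
      intro x hx hx'
      exact hIt (Interp.nodeMap_mem_conceptExt hI (canonical_conceptExt.1 hx))
        (Interp.nodeMap_mem_conceptExt hI (canonical_conceptExt.1 hx'))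
  | rangeIncl U T => exact absurd trivial hpos
  | roleIncl Q R =>
    cases R with
    | pos Q' => exact absurd trivial hpos
    | neg Q' =>
      intro x y hxy hxy'
      obtain ⟨Q₀, h, hb⟩ := canonical_roleExt.1 hxy
      obtain ⟨Q₁, h', hb'⟩ := canonical_roleExt.1 hxy'
      exact hIt _ _ (Interp.roleExt_of_roleSub hI.1 h (Interp.roleExt_nodeMap hI hb))
        (Interp.roleExt_of_roleSub hI.1 h' (Interp.roleExt_nodeMap hI hb'))
  | attrIncl U V =>
    cases V with
    | pos U' => exact absurd trivial hpos
    | neg U' =>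
      intro x v hxv hxv'
      exact hIt _ _ (hg _ _ _ hxv) (hg _ _ _ hxv')
  | funct U =>
    rintro x v w ⟨U₀, h, hv⟩ ⟨U₁, h', hw⟩
    -- Only base edges remain, and a node with an asserted value gets no fresh one; two asserted
    -- values are compared in `I`.
    obtain rfl := AttrSub.eq_of_not_specialized h (h𝒯.funct_attr _ ht)
    obtain rfl := AttrSub.eq_of_not_specialized h' (h𝒯.funct_attr _ ht)
    cases hv with
    | asserted hv =>
      cases hw with
      | asserted hw => exact hIt _ _ _ (hI.2 _ hv) (hI.2 _ hw)
      | fresh _ hw => exact absurd hv (hw _ _ rfl)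
    | fresh _ hv =>
      cases hw with
      | asserted hw => exact absurd hw (hv _ _ rfl)
      | fresh _ _ => rfl
  | ident B ps =>
    intro x hx y hy hps
    -- For two constants, the shared fillers are transported to `I`, and injectivity on constants
    -- brings the equality back.
    suffices h : x = y ∨ ∃ a b, x = .const a ∧ y = .const b by
      rcases h with h | ⟨a, b, rfl, rfl⟩
      · exact h
      · have hab : I.obj a = I.obj b := by
          refine hIt _ (Interp.nodeMap_mem_conceptExt hI (canonical_conceptExt.1 hx)) _
            (Interp.nodeMap_mem_conceptExt hI (canonical_conceptExt.1 hy)) fun p hp => ?_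
          obtain ⟨z, h₁, h₂⟩ := hps p hp
          exact ⟨_, canonical_pathExt_map hI hg p h₁, canonical_pathExt_map hI hg p h₂⟩
        rw [I.obj_injective hab]
    obtain ⟨p, hp, hsingle⟩ := h𝒯.ident_local B ps ht
    obtain ⟨z, h₁, h₂⟩ := hps p hp
    cases p with
    | role Q =>
      obtain ⟨x', z', hx', rfl, h₁⟩ := h₁
      obtain ⟨y', z'', hy', hz, h₂⟩ := h₂
      cases hx'; cases hy'; cases hz
      obtain ⟨Q₀, h, hb⟩ := canonical_roleExt.1 h₁
      obtain ⟨Q₁, h', hb'⟩ := canonical_roleExt.1 h₂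
      have hQ := h𝒯.ident_role B ps ht _ hp Q.name rfl
      obtain rfl := RoleSub.eq_of_not_specialized h hQ
      obtain rfl := RoleSub.eq_of_not_specialized h' hQ
      exact hb.eq_or_const hb'
    | attr U =>
      obtain ⟨x', z', hx', rfl, U₀, h, hb⟩ := h₁
      obtain ⟨y', z'', hy', hz, U₁, h', hb'⟩ := h₂
      cases hx'; cases hy'; cases hz
      have hU := h𝒯.ident_attr B ps ht _ hp U rfl
      obtain rfl := AttrSub.eq_of_not_specialized h hU
      obtain rfl := AttrSub.eq_of_not_specialized h' hU
      exact hν.eq_or_const hb hb' rfl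
    | test B' => exact hsingle.elim
    | comp p q => exact hsingle.elim

end Hom

/-! ### Choice of fresh values -/

/-- The values that belong to all domains prescribed for the attribute. -/
def admissible (𝔇 : Datatypes S) (𝒯 : Set (TAssertion S)) (U : S.AttrName) : Set 𝔇.Val :=
  {v | ∀ U' D, AttrSub 𝒯 U U' → .rangeIncl U' (.dom D) ∈ 𝒯 → v ∈ 𝔇.ext D}

theorem Interp.mem_admissible {I : Interp 𝔇} (hI : ∀ t ∈ positivePart 𝒯, I.satT t)
    {U : S.AttrName} {x : I.Obj} {v : 𝔇.Val} (h : I.attr U x v) : v ∈ admissible 𝔇 𝒯 U :=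
  fun _ _ hU hD => hI _ ⟨hD, trivial⟩ x v (attr_of_attrSub hI hU h)

theorem infinite_admissible (h𝒯 : 𝒯.Finite) {U : S.AttrName} {v : 𝔇.Val}
    (hv : v ∈ admissible 𝔇 𝒯 U) : (admissible 𝔇 𝒯 U).Infinite := by
  classical
  -- `D₀` keeps the family nonempty when no range inclusion applies, and still contains `v`.
  obtain ⟨D₀, hD₀⟩ := 𝔇.cover v
  have hfin : {D | ∃ U', AttrSub 𝒯 U U' ∧ TAssertion.rangeIncl U' (.dom D) ∈ 𝒯}.Finite := by
    refine (h𝒯.biUnion (t := fun t => {D | ∃ U', t = TAssertion.rangeIncl U' (.dom D)})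
      fun t _ => Set.Subsingleton.finite ?_).subset ?_
    · rintro D ⟨U₁, rfl⟩ D' ⟨U₂, h⟩
      simp_all
    · rintro D ⟨U', -, hD⟩
      exact Set.mem_iUnion₂.2 ⟨_, hD, U', rfl⟩
  rcases 𝔇.inter_empty_or_infinite (insert D₀ hfin.toFinset) (Finset.insert_nonempty _ _) with
    h | h
  · refine absurd (h ▸ ?_ : v ∈ (∅ : Set 𝔇.Val)) (Set.notMem_empty v)
    refine Set.mem_iInter₂.2 fun D hD => ?_
    rcases Finset.mem_insert.1 hD with rfl | hD
    · exact hD₀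
    · obtain ⟨U', hU, hD⟩ := hfin.mem_toFinset.1 hD
      exact hv U' D hU hD
  · refine h.mono fun w hw U' D hU hD => ?_
    exact Set.mem_iInter₂.1 hw D (Finset.mem_insert_of_mem (hfin.mem_toFinset.2 ⟨U', hU, hD⟩))

theorem exists_isFresh (h𝒯 : 𝒯.Finite) (h𝒜 : 𝒜.Finite)
    (h : ∀ x U, .dom U ∈ Node.type 𝒯 𝒜 x → (admissible 𝔇 𝒯 U).Nonempty) :
    ∃ ν : Node.ValueChoice 𝔇 𝒯 𝒜, IsFresh 𝔇 𝒯 𝒜 ν ∧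
      ∀ x U hx, ν x U hx ∈ admissible 𝔇 𝒯 U := by
  have hinj : Function.Injective
      (fun q : Node S × S.AttrName => (q.1, BasicConcept.dom q.2)) := by
    rintro ⟨x, U⟩ ⟨y, U'⟩ h
    simpa using h
  have hcount := (Node.countable_type h𝒯 h𝒜).preimage hinj
  have hF : {v | ∃ U a c, Fact.attr U a c ∈ 𝒜 ∧ 𝔇.val c = v}.Finite := by
    refine (h𝒜.biUnion (t := fun f => {v | ∃ U a c, f = Fact.attr U a c ∧ 𝔇.val c = v})
      fun f _ => Set.Subsingleton.finite ?_).subset ?_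
    · rintro v ⟨U, a, c, rfl, rfl⟩ w ⟨U', a', c', h, rfl⟩
      simp_all
    · rintro v ⟨U, a, c, hf, hv⟩
      exact Set.mem_iUnion₂.2 ⟨_, hf, U, a, c, rfl, hv⟩
  have : Countable {q : Node S × S.AttrName // .dom q.2 ∈ q.1.type 𝒯 𝒜} := hcount.to_subtype
  obtain ⟨f, hf, hfD⟩ := exists_injective_mem_of_infinite
    (D := fun q : {q : Node S × S.AttrName // .dom q.2 ∈ q.1.type 𝒯 𝒜} => admissible 𝔇 𝒯 q.1.2)
    (fun q => infinite_admissible h𝒯 (h q.1.1 q.1.2 q.2).choose_spec) hF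
  refine ⟨fun x U hx => f ⟨(x, U), hx⟩, ⟨fun x U y U' hx hy hxy => ?_,
    fun x U hx U' a c hc heq => ?_⟩, fun x U hx => (hfD ⟨(x, U), hx⟩).1⟩
  · exact Prod.mk.inj (Subtype.mk.inj (hf hxy))
  · exact (hfD ⟨(x, U), hx⟩).2 ⟨U', a, c, hc, heq.symm⟩

/-! ### Satisfiability of unions -/

/-- If `⟨𝒯, 𝒜⟩` and `⟨𝒯, ℬ⟩` are satisfiable and each negative assertion of `𝒯` is satisfiable
together with the positive inclusions and `𝒜 ∪ ℬ`, then `⟨𝒯, 𝒜 ∪ ℬ⟩` is satisfiable. -/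
theorem satisfiable_union (h𝒯 : IsTBox 𝒯) {ℬ : Set (Fact S)} (h𝒜 : 𝒜.Finite) (hℬ : ℬ.Finite)
    (hsat𝒜 : Satisfiable 𝔇 𝒯 𝒜) (hsatℬ : Satisfiable 𝔇 𝒯 ℬ) [Nonempty S.ObjConst]
    (h : ∀ t ∈ 𝒯 \ positivePart 𝒯, Satisfiable 𝔇 (positivePart 𝒯 ∪ {t}) (𝒜 ∪ ℬ)) :
    Satisfiable 𝔇 𝒯 (𝒜 ∪ ℬ) := by
  obtain ⟨a₀⟩ := ‹Nonempty S.ObjConst›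
  obtain ⟨I, hI⟩ := hsat𝒜
  obtain ⟨J, hJ⟩ := hsatℬ
  have hI' : I.IsModel (positivePart 𝒯) 𝒜 := ⟨fun t ht => hI.1 t ht.1, hI.2⟩
  have hJ' : J.IsModel (positivePart 𝒯) ℬ := ⟨fun t ht => hJ.1 t ht.1, hJ.2⟩
  -- The membership already arises from one of the two ABoxes, whose model exhibits an admissible
  -- value.
  have hadm : ∀ x U, .dom U ∈ Node.type 𝒯 (𝒜 ∪ ℬ) x → (admissible 𝔇 𝒯 U).Nonempty := by
    intro x U hU
    rcases Node.type_union hU with hU | hU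
    · obtain ⟨v, hv⟩ := Interp.nodeMap_mem_conceptExt hI' hU
      exact ⟨v, Interp.mem_admissible hI'.1 hv⟩
    · obtain ⟨v, hv⟩ := Interp.nodeMap_mem_conceptExt hJ' hU
      exact ⟨v, Interp.mem_admissible hJ'.1 hv⟩
  obtain ⟨ν, hν, hνD⟩ : ∃ ν : Node.ValueChoice 𝔇 𝒯 (𝒜 ∪ ℬ), IsFresh 𝔇 𝒯 (𝒜 ∪ ℬ) ν ∧
      ∀ x U hx, ν x U hx ∈ admissible 𝔇 𝒯 U :=
    exists_isFresh h𝒯.finite (h𝒜.union hℬ) hadm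
  refine ⟨canonical 𝔇 𝒯 (𝒜 ∪ ℬ) a₀ ν, fun t ht => ?_, fun f hf => canonical_satF hf⟩
  by_cases hpos : t.IsPositive
  · refine canonical_satT_of_isPositive (fun U U' x v D hb hU hD => ?_) ⟨ht, hpos⟩
    cases hb with
    | asserted hf =>
      rcases hf with hf | hf
      · exact Interp.mem_admissible hI'.1 (hI.2 _ hf) U' D hU hD
      · exact Interp.mem_admissible hJ'.1 (hJ.2 _ hf) U' D hU hD
    | fresh hx _ => exact hνD x U hx U' D hU hD
  -- A different `K` for each `t` is enough, because the canonical model is the same for all of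
  -- them.
  · obtain ⟨K, hK⟩ := h t ⟨ht, fun h => hpos h.2⟩
    exact hν.canonical_satT h𝒯 ⟨fun s hs => hK.1 s (.inl hs), hK.2⟩ ht hpos (hK.1 t (.inr rfl))

theorem Satisfiable.mono {𝒯' : Set (TAssertion S)} {𝒜' : Set (Fact S)} (h : Satisfiable 𝔇 𝒯 𝒜)
    (h𝒯 : 𝒯' ⊆ 𝒯) (h𝒜 : 𝒜' ⊆ 𝒜) : Satisfiable 𝔇 𝒯' 𝒜' :=
  let ⟨I, hI⟩ := h
  ⟨I, fun t ht => hI.1 t (h𝒯 ht), fun f hf => hI.2 f (h𝒜 hf)⟩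

/-- An unsatisfiable finite ABox contains a minimal unsatisfiable one. -/
theorem exists_minimal_not_satisfiable (h𝒜 : 𝒜.Finite) (h : ¬ Satisfiable 𝔇 𝒯 𝒜) :
    ∃ V ⊆ 𝒜, ¬ Satisfiable 𝔇 𝒯 V ∧ ∀ V', V' ⊂ V → Satisfiable 𝔇 𝒯 V' := by
  have hfin : {V | V ⊆ 𝒜 ∧ ¬ Satisfiable 𝔇 𝒯 V}.Finite :=
    h𝒜.finite_subsets.subset fun V hV => hV.1
  obtain ⟨V, hV⟩ := hfin.exists_minimal ⟨𝒜, subset_rfl, h⟩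
  refine ⟨V, hV.1.1, hV.1.2, fun V' hV' => ?_⟩
  by_contra hns
  exact hV'.2 (hV.2 ⟨hV'.1.trans hV.1.1, hns⟩ hV'.1)

theorem subset_closure (𝔇 : Datatypes S) (𝒯 : Set (TAssertion S)) (𝒜 : Set (Fact S)) :
    𝒜 ⊆ closure 𝔇 𝒯 𝒜 :=
  fun f hf => ⟨Set.subset_biUnion_of_mem (u := Fact.objs) hf,
    Set.subset_biUnion_of_mem (u := Fact.vals) hf, fun _ hI => hI.2 f hf⟩

end DLLite

theorem mainTheorem4 {S : DLLite.Signature.{u}} (𝔇 : DLLite.Datatypes S)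
    (𝒯 : Set (DLLite.TAssertion S)) (h𝒯 : DLLite.IsTBox 𝒯)
    (𝒜 : Set (DLLite.Fact S)) (h𝒜 : 𝒜.Finite)
    (hsat : DLLite.Satisfiable 𝔇 𝒯 𝒜)
    (α : DLLite.Fact S) (hα : DLLite.Satisfiable 𝔇 𝒯 {α})
    (hunsat : ¬ DLLite.Satisfiable 𝔇 𝒯 (𝒜 ∪ {α})) :
    ∃ V : Set (DLLite.Fact S), DLLite.IsViolationSet 𝔇 𝒯 V ∧
      V ⊆ DLLite.closure 𝔇 𝒯 (𝒜 ∪ {α}) ∧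
      α ∈ V ∧
      V \ {α} ⊆ DLLite.closure 𝔇 𝒯 𝒜 := by
  have : Nonempty S.ObjConst := by
    cases α with
    | concept _ a => exact ⟨a⟩
    | role _ a _ => exact ⟨a⟩
    | attr _ a _ => exact ⟨a⟩
  obtain ⟨t, ht, hns⟩ : ∃ t ∈ 𝒯 \ DLLite.positivePart 𝒯,
      ¬ DLLite.Satisfiable 𝔇 (DLLite.positivePart 𝒯 ∪ {t}) (𝒜 ∪ {α}) := by
    by_contra! h
    exact hunsat (DLLite.satisfiable_union h𝒯 h𝒜 (Set.finite_singleton α) hsat hα h)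
  obtain ⟨V, hV, hVns, hVmin⟩ :=
    DLLite.exists_minimal_not_satisfiable (h𝒜.union (Set.finite_singleton α)) hns
  have hsub : DLLite.positivePart 𝒯 ∪ {t} ⊆ 𝒯 :=
    Set.union_subset (fun _ h => h.1) (Set.singleton_subset_iff.2 ht.1)
  have hdiff : V \ {α} ⊆ 𝒜 := fun f hf => (hV hf.1).resolve_right hf.2
  refine ⟨V, ⟨t, ht, hVns, hVmin⟩, hV.trans (DLLite.subset_closure 𝔇 𝒯 _), ?_,
    hdiff.trans (DLLite.subset_closure 𝔇 𝒯 𝒜)⟩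
  -- Without `α`, `V` would lie in `𝒜`, which is satisfiable with all of `𝒯`.
  by_contra hα'
  refine hVns (hsat.mono hsub ?_)
  exact fun f hf => hdiff ⟨hf, fun h => hα' (h ▸ hf)⟩
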